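/- Let $r\ge 0$ be an integer, $\sigma>0$, and for $i=1,\dots,r$ let $p_i\ge 0$ and $s_i\in\mathbb R$. Let $x_1,\dots,x_r,n_1,\dots,n_r$ be mutually independent complex random variables with $x_i\sim\mathcal{CN}(0,p_i)$ and $n_i\sim\mathcal{CN}(0,\sigma^2)$ (circularly symmetric complex Gaussians), and consider the parallel channels $y_i=s_ix_i+n_i$. Each stream is quantized separately, $z_i=Q_i(y_i)$, where $Q_i:\mathbb C\to\mathbb C$ is a measurable map with the conditional-mean property $\mathbb E[y_i\mid Q_i(y_i)]=Q_i(y_i)$ almost surely (as is the case for a Lloyd--Max quantizer with any number of bits), and let $\beta_i=\mathbb E[|z_i-y_i|^2]/\mathbb E[|y_i|^2]$ be its distortion factor. Then $$R=\sum_{i=1}^{r}\log_2\!\left(1+\frac{(1-\beta_i)p_is_i^2}{\beta_ip_is_i^2+\sigma^2}\right)$$ is an achievable data rate of the quantized channel, in the sense that it is a lower bound on the mutual information (in bits) between input and quantized output: $I\big((x_1,\dots,x_r);(z_1,\dots,z_r)\big)\ge R$. Moreover the bound holds stream by stream: for every $i$, $$I(x_i;z_i)\ge\log_2\!\left(1+\frac{(1-\beta_i)p_is_i^2}{\beta_ip_is_i^2+\sigma^2}\right).$$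 -/

import Mathlib

open MeasureTheory ProbabilityTheory
open scoped NNReal ENNReal

/-- The circularly symmetric complex Gaussian law `CN(0, v)`: the real and imaginary parts are
independent real Gaussians with mean `0` and variance `v / 2`. -/
noncomputable def complexGaussian (v : ℝ≥0) : Measure ℂ :=
  ((gaussianReal 0 (v / 2)).prod (gaussianReal 0 (v / 2))).map
    Complex.measurableEquivRealProd.symm

/-- The mutual information `I(X; Y)` in bits: the Kullback-Leibler divergence between the joint law
of `(X, Y)` and the product of the marginal laws, divided by `log 2`. -/
noncomputable def mutualInfoBits {Ω E F : Type*} [MeasurableSpace Ω] [MeasurableSpace E]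
    [MeasurableSpace F] (μ : Measure Ω) (X : Ω → E) (Y : Ω → F) : ℝ≥0∞ :=
  InformationTheory.klDiv (μ.map (fun ω => (X ω, Y ω))) ((μ.map X).prod (μ.map Y)) /
    ENNReal.ofReal (Real.log 2)

/-- The conditional-mean property of a quantizer `Q` for the input `y`: `E[y | Q(y)] = Q(y)`
almost surely. -/
def HasConditionalMeanProperty {Ω : Type*} [MeasurableSpace Ω] (μ : Measure Ω)
    (y : Ω → ℂ) (Q : ℂ → ℂ) : Prop :=
  μ[y | MeasurableSpace.comap (fun ω => Q (y ω)) Complex.measurableSpace] =ᵐ[μ] fun ω => Q (y ω)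

/-- The distortion factor `β = E[|z - y|²] / E[|y|²]` of the quantized version `z` of `y`. -/
noncomputable def distortionFactor {Ω : Type*} [MeasurableSpace Ω] (μ : Measure Ω)
    (y z : Ω → ℂ) : ℝ :=
  (∫ ω, ‖z ω - y ω‖ ^ 2 ∂μ) / (∫ ω, ‖y ω‖ ^ 2 ∂μ)

/-! Mutual information is bounded below by testing the joint law against a Gaussian reverse channel:
if `∫ exp f dρ = 1` then `∫ f dπ ≤ KL(π‖ρ)` (`integral_le_klDiv`). Here `f(x, z)` is the log-ratio
of the densities of `CN(c z, D)` and `CN(0, p)`, with `V = p s² + τ = E|y|²` (`τ = σ²`), `c = p s /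
V` the Wiener coefficient and `D = E|x - c z|²`.

Since `x - c y` is independent of `y`, hence of `z`, and `E[y | z] = z`, one gets `E[x | z] = c z`
(`HasConditionalMeanProperty.condExp_input`). The conditional-mean property also makes `z - y`
orthogonal to `z`, so `E|z|² = (1 - β) V`. Therefore `D = p - c² (1 - β) V = p (β p s² + τ) / V`,
and `E f = log (p / D)` is the claimed rate in nats. For the vector bound, the sum of the `f i` is
again a normalized test function because the inputs are independent. -/

/-! ### Variational lower bound on divergence and mutual information. -/

/-- The tilted measure `exp f · ρ` is a probability measure, and `0 ≤ KL(π‖exp f · ρ) = KL(π‖ρ) - ∫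
f dπ`. -/
theorem integral_le_klDiv {α : Type*} [MeasurableSpace α] (π ρ : Measure α)
    [IsProbabilityMeasure π] [IsProbabilityMeasure ρ] {f : α → ℝ} (hf : Measurable f)
    (hfπ : Integrable f π) (hexp : ∫⁻ a, ENNReal.ofReal (Real.exp (f a)) ∂ρ = 1) :
    ((∫ a, f a ∂π : ℝ) : EReal) ≤ (InformationTheory.klDiv π ρ : EReal) := by
  by_cases htop : InformationTheory.klDiv π ρ = ∞
  · simp [htop]
  obtain ⟨hac, hint⟩ := InformationTheory.klDiv_ne_top_iff.1 htop
  have hexp_int : Integrable (fun a => Real.exp (f a)) ρ := by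
    refine ⟨hf.exp.aestronglyMeasurable, ?_⟩
    rw [hasFiniteIntegral_iff_ofReal (.of_forall fun a => (Real.exp_pos _).le), hexp]
    simp
  have hexp_one : ∫ a, Real.exp (f a) ∂ρ = 1 := by
    rw [integral_eq_lintegral_of_nonneg_ae (.of_forall fun a => (Real.exp_pos _).le)
      hf.exp.aestronglyMeasurable, hexp, ENNReal.toReal_one]
  have : IsProbabilityMeasure (ρ.tilted f) := isProbabilityMeasure_tilted hexp_int
  have h := InformationTheory.integral_llr_add_sub_measure_univ_nonneg
    (hac.trans (absolutelyContinuous_tilted hexp_int))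
    (integrable_llr_tilted_right hac hfπ hint hexp_int)
  rw [integral_llr_tilted_right hac hfπ hexp_int hint, hexp_one] at h
  have hkl := InformationTheory.toReal_klDiv hac hint
  rw [← EReal.coe_toReal (x := (InformationTheory.klDiv π ρ : EReal)) (by simpa using htop)
    (by simp)]
  rw [EReal.coe_le_coe_iff, EReal.toReal_coe_ennreal, hkl]
  simp at h ⊢
  linarith

/-- By Tonelli, normalizing `exp f` in `x` for each fixed `y` normalizes it under the product of the
marginals, whatever the law of `Y`. -/
theorem integral_div_log_two_le_mutualInfoBits {Ω E F : Type*} [MeasurableSpace Ω]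
    [MeasurableSpace E] [MeasurableSpace F] (μ : Measure Ω) [IsProbabilityMeasure μ]
    {X : Ω → E} {Y : Ω → F} (hX : Measurable X) (hY : Measurable Y) {f : E × F → ℝ}
    (hf : Measurable f) (hint : Integrable (fun ω => f (X ω, Y ω)) μ)
    (hexp : ∀ y, ∫⁻ x, ENNReal.ofReal (Real.exp (f (x, y))) ∂(μ.map X) = 1) :
    (((∫ ω, f (X ω, Y ω) ∂μ) / Real.log 2 : ℝ) : EReal) ≤ (mutualInfoBits μ X Y : EReal) := by
  have hXY : Measurable fun ω => (X ω, Y ω) := hX.prodMk hY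
  have := Measure.isProbabilityMeasure_map (μ := μ) hX.aemeasurable
  have := Measure.isProbabilityMeasure_map (μ := μ) hY.aemeasurable
  have := Measure.isProbabilityMeasure_map (μ := μ) hXY.aemeasurable
  have hle := integral_le_klDiv (μ.map fun ω => (X ω, Y ω)) ((μ.map X).prod (μ.map Y)) hf
    ((integrable_map_measure hf.aestronglyMeasurable hXY.aemeasurable).2 hint) (by
      rw [lintegral_prod_symm' _ (by fun_prop)]
      simp [hexp])
  rw [integral_map hXY.aemeasurable hf.aestronglyMeasurable] at hle
  have hlog : 0 < Real.log 2 := Real.log_pos one_lt_two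
  rw [mutualInfoBits]
  set K := InformationTheory.klDiv (μ.map fun ω => (X ω, Y ω)) ((μ.map X).prod (μ.map Y))
  by_cases hK : K = ∞
  · simp [hK, ENNReal.top_div]
  rw [← EReal.coe_toReal (x := (K : EReal)) (by simpa using hK) (by simp),
    EReal.coe_le_coe_iff, EReal.toReal_coe_ennreal] at hle
  have hne : K / ENNReal.ofReal (Real.log 2) ≠ ∞ :=
    ENNReal.div_ne_top hK (by simpa using hlog)
  rw [← EReal.coe_toReal (x := ((K / ENNReal.ofReal (Real.log 2) : ℝ≥0∞) : EReal))
    (by simpa using hne) (by simp), EReal.coe_le_coe_iff, EReal.toReal_coe_ennreal,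
    ENNReal.toReal_div, ENNReal.toReal_ofReal hlog.le]
  gcongr

/-! ### Gaussian density ratios and the law `CN(0, v)`. -/

/-- The integrand is the density of `N(m, w)` with respect to `N(0, v)`. -/
theorem lintegral_exp_gaussianReal_logRatio (m : ℝ) {v w : ℝ≥0} (hv : v ≠ 0) (hw : w ≠ 0) :
    ∫⁻ x, ENNReal.ofReal (Real.exp (Real.log (v / w) / 2 - (x - m) ^ 2 / (2 * w)
      + x ^ 2 / (2 * v))) ∂(gaussianReal 0 v) = 1 := by
  rw [gaussianReal_of_var_ne_zero _ hv,
    lintegral_withDensity_eq_lintegral_mul _ (measurable_gaussianPDF _ _) (by fun_prop),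
    ← lintegral_gaussianPDF_eq_one m hw]
  refine lintegral_congr fun x => ?_
  have hv' : (0 : ℝ) < v := by positivity
  have hw' : (0 : ℝ) < w := by positivity
  rw [Pi.mul_apply, gaussianPDF, gaussianPDF, ← ENNReal.ofReal_mul (gaussianPDFReal_nonneg _ _ _)]
  congr 1
  rw [gaussianPDFReal, gaussianPDFReal, mul_assoc, ← Real.exp_add]
  have h1 : -(x - 0) ^ 2 / (2 * v) + (Real.log (v / w) / 2 - (x - m) ^ 2 / (2 * w)
      + x ^ 2 / (2 * v)) = Real.log (v / w) / 2 + -(x - m) ^ 2 / (2 * w) := by ring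
  have hpi := Real.pi_pos
  have hw'' : 0 < √(2 * Real.pi * w) := Real.sqrt_pos.2 (by positivity)
  have hv'' : 0 < √(2 * Real.pi * v) := Real.sqrt_pos.2 (by positivity)
  have h2 : Real.exp (Real.log (v / w) / 2) = √(2 * Real.pi * v) / √(2 * Real.pi * w) := by
    rw [← Real.log_sqrt (by positivity), Real.exp_log (Real.sqrt_pos.2 (by positivity)),
      ← Real.sqrt_div (by positivity)]
    congr 1
    field_simp
  rw [h1, Real.exp_add, h2]
  field_simp

instance isGaussian_complexGaussian (v : ℝ≥0) : IsGaussian (complexGaussian v) := by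
  have h : (Complex.measurableEquivRealProd.symm : ℝ × ℝ → ℂ)
      = Complex.equivRealProdCLM.symm := by
    ext x; rfl
  rw [complexGaussian, h]
  infer_instance

theorem map_re_complexGaussian (v : ℝ≥0) :
    (complexGaussian v).map Complex.re = gaussianReal 0 (v / 2) := by
  rw [complexGaussian, Measure.map_map Complex.measurable_re (by fun_prop)]
  exact Measure.fst_prod

theorem map_im_complexGaussian (v : ℝ≥0) :
    (complexGaussian v).map Complex.im = gaussianReal 0 (v / 2) := by
  rw [complexGaussian, Measure.map_map Complex.measurable_im (by fun_prop)]
  exact Measure.snd_prod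

theorem indepFun_re_im_complexGaussian (v : ℝ≥0) :
    IndepFun Complex.re Complex.im (complexGaussian v) := by
  rw [indepFun_iff_map_prod_eq_prod_map_map Complex.measurable_re.aemeasurable
    Complex.measurable_im.aemeasurable, map_re_complexGaussian, map_im_complexGaussian,
    complexGaussian, Measure.map_map (by fun_prop) (by fun_prop)]
  exact Measure.map_id

/-- The ratio factors over real and imaginary parts; their variances `v / 2` and `w / 2` absorb the
factors `2` of the real exponent. -/
theorem lintegral_exp_complexGaussian_logRatio (m : ℂ) {v w : ℝ≥0} (hv : v ≠ 0) (hw : w ≠ 0) :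
    ∫⁻ x, ENNReal.ofReal (Real.exp (Real.log (v / w) - ‖x - m‖ ^ 2 / w + ‖x‖ ^ 2 / v))
      ∂(complexGaussian v) = 1 := by
  have key : ∀ m : ℝ, ∫⁻ x, ENNReal.ofReal (Real.exp (Real.log (v / w) / 2 - (x - m) ^ 2 / w
      + x ^ 2 / v)) ∂(gaussianReal 0 (v / 2)) = 1 := fun m => by
    rw [← lintegral_exp_gaussianReal_logRatio m (v := v / 2) (w := w / 2)
      (by positivity) (by positivity)]
    refine lintegral_congr fun x => ?_
    have h1 : ((v / 2 : ℝ≥0) : ℝ) / ((w / 2 : ℝ≥0) : ℝ) = v / w := by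
      push_cast; field_simp
    rw [h1]
    congr 4 <;> · push_cast; field_simp
  rw [complexGaussian, lintegral_map (by fun_prop) (by fun_prop)]
  have h : ∀ a : ℝ × ℝ, ENNReal.ofReal (Real.exp (Real.log (v / w)
        - ‖Complex.measurableEquivRealProd.symm a - m‖ ^ 2 / w
        + ‖Complex.measurableEquivRealProd.symm a‖ ^ 2 / v))
      = ENNReal.ofReal (Real.exp (Real.log (v / w) / 2 - (a.1 - m.re) ^ 2 / w + a.1 ^ 2 / v))
        * ENNReal.ofReal (Real.exp (Real.log (v / w) / 2 - (a.2 - m.im) ^ 2 / w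
          + a.2 ^ 2 / v)) := fun a => by
    rw [← ENNReal.ofReal_mul (Real.exp_pos _).le, ← Real.exp_add]
    congr 2
    rw [← Complex.normSq_eq_norm_sq, ← Complex.normSq_eq_norm_sq, Complex.normSq_apply,
      Complex.normSq_apply]
    simp only [Complex.measurableEquivRealProd_symm_apply, Complex.sub_re, Complex.sub_im]
    ring
  simp_rw [h]
  rw [lintegral_prod_mul
    (f := fun t => ENNReal.ofReal (Real.exp (Real.log (v / w) / 2 - (t - m.re) ^ 2 / w + t ^ 2 / v)))
    (g := fun t => ENNReal.ofReal (Real.exp (Real.log (v / w) / 2 - (t - m.im) ^ 2 / w + t ^ 2 / v)))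
    (by fun_prop) (by fun_prop), key, key, one_mul]

/-! ### Moments of complex Gaussians and conditional expectations. -/

section Moments

variable {Ω : Type*} [MeasurableSpace Ω] {μ : Measure Ω} {X : Ω → ℂ} {v : ℝ≥0}

theorem hasGaussianLaw_of_map_eq_complexGaussian (hlaw : μ.map X = complexGaussian v) :
    HasGaussianLaw X μ := ⟨by rw [hlaw]; infer_instance⟩

theorem integral_eq_zero_of_map_eq_complexGaussian (hX : Measurable X)
    (hlaw : μ.map X = complexGaussian v) : ∫ ω, X ω ∂μ = 0 := by
  have hint : Integrable X μ := (hasGaussianLaw_of_map_eq_complexGaussian hlaw).integrable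
  have hre : ∫ ω, (X ω).re ∂μ = 0 := by
    rw [← integral_id_gaussianReal (μ := 0) (v := v / 2), ← map_re_complexGaussian, ← hlaw,
      Measure.map_map Complex.measurable_re hX,
      integral_map (Complex.measurable_re.comp hX).aemeasurable (by fun_prop)]
    rfl
  have him : ∫ ω, (X ω).im ∂μ = 0 := by
    rw [← integral_id_gaussianReal (μ := 0) (v := v / 2), ← map_im_complexGaussian, ← hlaw,
      Measure.map_map Complex.measurable_im hX,
      integral_map (Complex.measurable_im.comp hX).aemeasurable (by fun_prop)]
    rfl
  rw [← integral_re_add_im hint]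
  simp [hre, him]

/-- Circular symmetry: on `ℂ` seen as a real plane the covariance form is a multiple of the inner
product. This shape feeds the Gaussian independence criterion. -/
theorem covariance_inner_of_map_eq_complexGaussian (hX : Measurable X)
    (hlaw : μ.map X = complexGaussian v) (a b : ℂ) :
    cov[fun ω => inner ℝ a (X ω), fun ω => inner ℝ b (X ω); μ] = v / 2 * inner ℝ a b := by
  have hre : MemLp Complex.re 2 (complexGaussian v) :=
    IsGaussian.memLp_dual _ Complex.reCLM 2 (by simp)
  have him : MemLp Complex.im 2 (complexGaussian v) :=
    IsGaussian.memLp_dual _ Complex.imCLM 2 (by simp)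
  have hvre : Var[Complex.re; complexGaussian v] = v / 2 := by
    rw [← variance_id_map Complex.measurable_re.aemeasurable, map_re_complexGaussian,
      variance_id_gaussianReal]
    simp
  have hvim : Var[Complex.im; complexGaussian v] = v / 2 := by
    rw [← variance_id_map Complex.measurable_im.aemeasurable, map_im_complexGaussian,
      variance_id_gaussianReal]
    simp
  have hc := (indepFun_re_im_complexGaussian v).covariance_eq_zero hre him
  have hc' : cov[Complex.im, Complex.re; complexGaussian v] = 0 := by rw [covariance_comm, hc]
  have hinner : ∀ a : ℂ, (fun x : ℂ => inner ℝ a x)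
      = a.re • Complex.re + a.im • Complex.im := fun a => by
    ext x
    simp [Complex.inner, mul_comm]
  have h : cov[fun x : ℂ => inner ℝ a x, fun x : ℂ => inner ℝ b x; complexGaussian v]
      = v / 2 * inner ℝ a b := by
    rw [hinner, hinner, covariance_add_left (hre.const_smul _) (him.const_smul _)
      ((hre.const_smul _).add (him.const_smul _)),
      covariance_add_right (hre.const_smul _) (hre.const_smul _) (him.const_smul _),
      covariance_add_right (him.const_smul _) (hre.const_smul _) (him.const_smul _)]
    simp only [covariance_smul_left, covariance_smul_right, hc, hc',
      covariance_self Complex.measurable_re.aemeasurable,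
      covariance_self Complex.measurable_im.aemeasurable, hvre, hvim, Complex.inner]
    simp
    ring
  rw [← h, ← hlaw, covariance_map_fun (by fun_prop) (by fun_prop) hX.aemeasurable]

end Moments

theorem integral_sub_add {α : Type*} [MeasurableSpace α] {μ : Measure α} {f g h : α → ℝ}
    (hf : Integrable f μ) (hg : Integrable g μ) (hh : Integrable h μ) :
    ∫ a, (f a - g a + h a) ∂μ = ∫ a, f a ∂μ - ∫ a, g a ∂μ + ∫ a, h a ∂μ := by
  rw [integral_add (f := fun a => f a - g a) (hf.sub hg) hh, integral_sub hf hg]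

theorem integrable_inner_of_memLp_two {Ω : Type*} [MeasurableSpace Ω] {μ : Measure Ω}
    {f g : Ω → ℂ} (hf : MemLp f 2 μ) (hg : MemLp g 2 μ) :
    Integrable (fun ω => inner ℝ (f ω) (g ω)) μ := by
  refine (hf.norm.integrable_mul hg.norm).mono'
    (hf.aestronglyMeasurable.inner hg.aestronglyMeasurable) (.of_forall fun ω => ?_)
  simpa using abs_real_inner_le_norm (f ω) (g ω)

theorem memLp_two_of_map_eq_complexGaussian {Ω : Type*} [MeasurableSpace Ω]
    {μ : Measure Ω} {x : Ω → ℂ} {p : ℝ≥0} (hlaw : μ.map x = complexGaussian p) :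
    MemLp x 2 μ :=
  (hasGaussianLaw_of_map_eq_complexGaussian hlaw).memLp_two

theorem integral_inner_eq_of_condExp_eq {Ω : Type*} {m mΩ : MeasurableSpace Ω} {μ : Measure Ω}
    [IsProbabilityMeasure μ] (hm : m ≤ mΩ)
    {z u g : Ω → ℂ} (hz : StronglyMeasurable[m] z) (hz2 : MemLp z 2 μ) (hu : MemLp u 2 μ)
    (h : μ[u | m] =ᵐ[μ] g) :
    ∫ ω, inner ℝ (z ω) (u ω) ∂μ = ∫ ω, inner ℝ (z ω) (g ω) ∂μ := by
  have hpull : μ[fun ω => inner ℝ (z ω) (u ω) | m] =ᵐ[μ] fun ω => inner ℝ (z ω) (μ[u | m] ω) :=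
    condExp_bilin_of_aestronglyMeasurable_left (innerSL ℝ)
      hz.aestronglyMeasurable (integrable_inner_of_memLp_two hz2 hu) (hu.integrable one_le_two)
  rw [← integral_condExp hm, integral_congr_ae hpull]
  refine integral_congr_ae ?_
  filter_upwards [h] with ω hω
  rw [hω]

/-! ### Linear combinations of input and noise. -/

section Channel

variable {Ω : Type*} [MeasurableSpace Ω] {μ : Measure Ω}

theorem integral_norm_sq_eq_of_covariance_inner [IsProbabilityMeasure μ]
    {Y : Ω → ℂ} (hY : MemLp Y 2 μ)
    (hmean : ∫ ω, Y ω ∂μ = 0) {v : ℝ}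
    (hcov : ∀ a b : ℂ, cov[fun ω => inner ℝ a (Y ω), fun ω => inner ℝ b (Y ω); μ]
      = v / 2 * inner ℝ a b) :
    ∫ ω, ‖Y ω‖ ^ 2 ∂μ = v := by
  have hint : Integrable Y μ := hY.integrable one_le_two
  have hsq : ∀ a : ℂ, ∫ ω, inner ℝ a (Y ω) ^ 2 ∂μ = v / 2 * inner ℝ a a := fun a => by
    rw [← hcov a a, covariance_eq_sub (hY.const_inner a) (hY.const_inner a),
      integral_inner hint, hmean]
    simp [sq]
  have hsq_int : ∀ a : ℂ, Integrable (fun ω => inner ℝ a (Y ω) ^ 2) μ := fun a =>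
    (hY.const_inner a).integrable_sq
  have h : ∀ ω, ‖Y ω‖ ^ 2 = inner ℝ (1 : ℂ) (Y ω) ^ 2 + inner ℝ Complex.I (Y ω) ^ 2 := fun ω => by
    rw [← Complex.normSq_eq_norm_sq, Complex.normSq_apply]
    simp [Complex.inner]
    ring
  simp_rw [h]
  rw [integral_add (hsq_int _) (hsq_int _), hsq, hsq]
  simp

variable {x n : Ω → ℂ} {p τ : ℝ≥0}

theorem covariance_inner_linearCombination [IsProbabilityMeasure μ]
    (hx : Measurable x) (hn : Measurable n)
    (hx_law : μ.map x = complexGaussian p) (hn_law : μ.map n = complexGaussian τ)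
    (hxn : IndepFun x n μ) (k l k' l' : ℝ) (a b : ℂ) :
    cov[fun ω => inner ℝ a (k • x ω + l • n ω), fun ω => inner ℝ b (k' • x ω + l' • n ω); μ]
      = (k * k' * p + l * l' * τ) / 2 * inner ℝ a b := by
  have hx2 : ∀ a : ℂ, MemLp (fun ω => inner ℝ a (x ω)) 2 μ :=
    (memLp_two_of_map_eq_complexGaussian hx_law).const_inner
  have hn2 : ∀ a : ℂ, MemLp (fun ω => inner ℝ a (n ω)) 2 μ :=
    (memLp_two_of_map_eq_complexGaussian hn_law).const_inner
  have hc : ∀ a b : ℂ, cov[fun ω => inner ℝ a (x ω), fun ω => inner ℝ b (n ω); μ] = 0 :=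
    fun a b => IndepFun.covariance_eq_zero (hxn.comp (φ := fun t => inner ℝ a t)
      (ψ := fun t => inner ℝ b t) (by fun_prop) (by fun_prop)) (hx2 a) (hn2 b)
  have hc' : ∀ a b : ℂ, cov[fun ω => inner ℝ a (n ω), fun ω => inner ℝ b (x ω); μ] = 0 :=
    fun a b => by rw [covariance_comm, hc]
  have hlin : ∀ (a : ℂ) (k l : ℝ), (fun ω => inner ℝ a (k • x ω + l • n ω))
      = k • (fun ω => inner ℝ a (x ω)) + l • (fun ω => inner ℝ a (n ω)) := fun a k l => by
    ext ω
    simp only [inner_add_right, real_inner_smul_right, Pi.add_apply, Pi.smul_apply, smul_eq_mul]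
  rw [hlin, hlin, covariance_add_left ((hx2 a).const_smul _) ((hn2 a).const_smul _)
      (((hx2 b).const_smul _).add ((hn2 b).const_smul _)),
    covariance_add_right ((hx2 a).const_smul _) ((hx2 b).const_smul _) ((hn2 b).const_smul _),
    covariance_add_right ((hn2 a).const_smul _) ((hx2 b).const_smul _) ((hn2 b).const_smul _)]
  simp only [covariance_smul_left, covariance_smul_right, hc, hc',
    covariance_inner_of_map_eq_complexGaussian hx hx_law,
    covariance_inner_of_map_eq_complexGaussian hn hn_law]
  ring

theorem memLp_two_linearCombination (hx_law : μ.map x = complexGaussian p)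
    (hn_law : μ.map n = complexGaussian τ) (k l : ℝ) :
    MemLp (fun ω => k • x ω + l • n ω) 2 μ :=
  ((memLp_two_of_map_eq_complexGaussian hx_law).const_smul k).add
    ((memLp_two_of_map_eq_complexGaussian hn_law).const_smul l)

theorem integral_linearCombination_eq_zero [IsProbabilityMeasure μ]
    (hx : Measurable x) (hn : Measurable n)
    (hx_law : μ.map x = complexGaussian p) (hn_law : μ.map n = complexGaussian τ) (k l : ℝ) :
    ∫ ω, (k • x ω + l • n ω) ∂μ = 0 := by
  rw [integral_add (f := fun ω => k • x ω) (g := fun ω => l • n ω)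
    (((memLp_two_of_map_eq_complexGaussian hx_law).integrable one_le_two).smul k)
    (((memLp_two_of_map_eq_complexGaussian hn_law).integrable one_le_two).smul l),
    integral_smul, integral_smul, integral_eq_zero_of_map_eq_complexGaussian hx hx_law,
    integral_eq_zero_of_map_eq_complexGaussian hn hn_law]
  simp

/-- The two combinations are jointly Gaussian, so zero covariance gives independence. -/
theorem indepFun_linearCombination [IsProbabilityMeasure μ]
    (hx : Measurable x) (hn : Measurable n)
    (hx_law : μ.map x = complexGaussian p) (hn_law : μ.map n = complexGaussian τ)
    (hxn : IndepFun x n μ) {k l k' l' : ℝ} (h : k * k' * p + l * l' * τ = 0) :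
    IndepFun (fun ω => k • x ω + l • n ω) (fun ω => k' • x ω + l' • n ω) μ := by
  have hG := IndepFun.hasGaussianLaw (hasGaussianLaw_of_map_eq_complexGaussian hx_law)
    (hasGaussianLaw_of_map_eq_complexGaussian hn_law) hxn
  refine HasGaussianLaw.indepFun_of_covariance_inner
    (hG.map_fun (((k • ContinuousLinearMap.fst ℝ ℂ ℂ + l • ContinuousLinearMap.snd ℝ ℂ ℂ).prod
      (k' • ContinuousLinearMap.fst ℝ ℂ ℂ + l' • ContinuousLinearMap.snd ℝ ℂ ℂ)))) fun a b => ?_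
  rw [covariance_inner_linearCombination hx hn hx_law hn_law hxn, h]
  simp

end Channel

/-! ### Second-order statistics of the quantizer and the test function. -/

section Quantizer

variable {Ω : Type*} [MeasurableSpace Ω] {μ : Measure Ω}
  {x n y z : Ω → ℂ} {p τ : ℝ≥0} {s : ℝ} {Q : ℂ → ℂ}

theorem HasConditionalMeanProperty.memLp_two (hcm : HasConditionalMeanProperty μ y Q)
    (hy : MemLp y 2 μ) : MemLp (fun ω => Q (y ω)) 2 μ :=
  (hy.condExp one_le_two).ae_eq hcm

/-- Pythagoras: `z = E[y | z]` is the orthogonal projection of `y`. -/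
theorem HasConditionalMeanProperty.integral_norm_sub_sq [IsProbabilityMeasure μ]
    (hcm : HasConditionalMeanProperty μ y Q)
    (hym : Measurable y) (hQ : Measurable Q) (hy : MemLp y 2 μ) :
    ∫ ω, ‖Q (y ω) - y ω‖ ^ 2 ∂μ = ∫ ω, ‖y ω‖ ^ 2 ∂μ - ∫ ω, ‖Q (y ω)‖ ^ 2 ∂μ := by
  have hz := hcm.memLp_two hy
  have hzy := integral_inner_eq_of_condExp_eq (hQ.comp hym).comap_le
    (comap_measurable fun ω => Q (y ω)).stronglyMeasurable hz hy hcm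
  simp_rw [norm_sub_sq_real]
  rw [integral_sub_add (hz.integrable_norm_pow two_ne_zero)
    ((integrable_inner_of_memLp_two hz hy).const_mul 2) (hy.integrable_norm_pow two_ne_zero),
    integral_const_mul, hzy]
  simp_rw [real_inner_self_eq_norm_sq]
  ring

theorem integral_norm_sq_channel_output [IsProbabilityMeasure μ]
    (hx : Measurable x) (hn : Measurable n)
    (hx_law : μ.map x = complexGaussian p) (hn_law : μ.map n = complexGaussian τ)
    (hxn : IndepFun x n μ) (hy : ∀ ω, y ω = s • x ω + n ω) :
    ∫ ω, ‖y ω‖ ^ 2 ∂μ = s ^ 2 * p + τ := by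
  obtain rfl : y = fun ω => s • x ω + (1 : ℝ) • n ω := by ext ω; simp [hy]
  refine integral_norm_sq_eq_of_covariance_inner (memLp_two_linearCombination hx_law hn_law s 1)
    (integral_linearCombination_eq_zero hx hn hx_law hn_law s 1) fun a b => ?_
  rw [covariance_inner_linearCombination hx hn hx_law hn_law hxn]
  ring

/-- Write `x = (x - c y) + c y`: the first term is centred and independent of `z`, the second has
conditional mean `c z`. -/
theorem HasConditionalMeanProperty.condExp_input [IsProbabilityMeasure μ]
    (hcm : HasConditionalMeanProperty μ y Q)
    (hx : Measurable x) (hn : Measurable n)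
    (hx_law : μ.map x = complexGaussian p) (hn_law : μ.map n = complexGaussian τ)
    (hxn : IndepFun x n μ) (hy : ∀ ω, y ω = s • x ω + n ω) (hQ : Measurable Q)
    {c : ℝ} (hc : c * (s ^ 2 * p + τ) = p * s) :
    μ[x | MeasurableSpace.comap (fun ω => Q (y ω)) Complex.measurableSpace]
      =ᵐ[μ] fun ω => c • Q (y ω) := by
  have hye : y = fun ω => s • x ω + (1 : ℝ) • n ω := by ext ω; simp [hy]
  have hym : Measurable y := by rw [hye]; fun_prop
  have hy1 : Integrable y μ := by 
    rw [hye]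
    exact (memLp_two_linearCombination hx_law hn_law s 1).integrable one_le_two
  have hwm : Measurable fun ω => (1 - c * s) • x ω + (-c) • n ω := by fun_prop
  have hw1 : Integrable (fun ω => (1 - c * s) • x ω + (-c) • n ω) μ :=
    (memLp_two_linearCombination hx_law hn_law _ _).integrable one_le_two
  -- `x - c y = (1 - c s) x - c n`, and its covariance with `y` is proportional to `(1 - c s) s p -
  -- c τ`, which vanishes by `hc`.
  have hindep := indepFun_linearCombination hx hn hx_law hn_law hxn
    (k := 1 - c * s) (l := -c) (k' := s) (l' := 1) (by linear_combination -hc)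
  rw [← hye] at hindep
  have hle := (hQ.comp hym).comap_le
  have hle' : MeasurableSpace.comap (fun ω => Q (y ω)) Complex.measurableSpace
      ≤ MeasurableSpace.comap y Complex.measurableSpace := by
    change MeasurableSpace.comap (Q ∘ y) Complex.measurableSpace ≤ _
    rw [← MeasurableSpace.comap_comp]
    exact MeasurableSpace.comap_mono hQ.comap_le
  have hw := condExp_indep_eq (μ := μ) hwm.comap_le hle
    (comap_measurable fun ω => (1 - c * s) • x ω + (-c) • n ω).stronglyMeasurable
    (indep_of_indep_of_le_right hindep hle')
  have hxe : x = (fun ω => (1 - c * s) • x ω + (-c) • n ω) + c • y := by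
    ext1 ω
    simp only [Pi.add_apply, Pi.smul_apply, hy]
    module
  have hadd := condExp_add hw1 (hy1.smul c)
    (MeasurableSpace.comap (fun ω => Q (y ω)) Complex.measurableSpace)
  rw [← hxe] at hadd
  filter_upwards [hadd, hw, hcm, condExp_smul (μ := μ) c y
    (MeasurableSpace.comap (fun ω => Q (y ω)) Complex.measurableSpace)] with ω h1 h2 h3 h4
  rw [h1, Pi.add_apply, h4, Pi.smul_apply, h3]
  erw [h2]
  rw [integral_linearCombination_eq_zero hx hn hx_law hn_law, zero_add]

theorem exists_logDensityRatio_of_conditionalMean [IsProbabilityMeasure μ]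
    (hx : Measurable x) (hn : Measurable n)
    (hx_law : μ.map x = complexGaussian p) (hn_law : μ.map n = complexGaussian τ)
    (hτ : 0 < τ) (hxn : IndepFun x n μ) (hy : ∀ ω, y ω = s • x ω + n ω) (hQ : Measurable Q)
    (hz : ∀ ω, z ω = Q (y ω)) (hcm : HasConditionalMeanProperty μ y Q)
    {β : ℝ} (hβ : β = distortionFactor μ y z) :
    ∃ f : ℂ × ℂ → ℝ, Measurable f ∧ Integrable (fun ω => f (x ω, z ω)) μ ∧
      (∀ z, ∫⁻ x, ENNReal.ofReal (Real.exp (f (x, z))) ∂(complexGaussian p) = 1) ∧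
      ∫ ω, f (x ω, z ω) ∂μ = Real.log (1 + (1 - β) * p * s ^ 2 / (β * p * s ^ 2 + τ)) := by
  -- With `p = 0` the Gaussian ratio degenerates, but the rate is `0` and `f = 0` suffices.
  rcases eq_or_ne p 0 with rfl | hp
  · exact ⟨0, measurable_zero, by simp, by simp, by simp⟩
  obtain rfl : z = fun ω => Q (y ω) := funext hz
  have hp' : (0 : ℝ) < p := by positivity
  have hτ' : (0 : ℝ) < τ := hτ
  have hx2 := memLp_two_of_map_eq_complexGaussian hx_law
  have hn2 := memLp_two_of_map_eq_complexGaussian hn_law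
  have hye : y = fun ω => s • x ω + n ω := funext hy
  have hym : Measurable y := by rw [hye]; fun_prop
  have hy2 : MemLp y 2 μ := by rw [hye]; exact (hx2.const_smul s).add hn2
  have hz2 := hcm.memLp_two hy2
  have hEy := integral_norm_sq_channel_output hx hn hx_law hn_law hxn hy
  have hEx : ∫ ω, ‖x ω‖ ^ 2 ∂μ = p := by
    refine integral_norm_sq_eq_of_covariance_inner hx2
      (integral_eq_zero_of_map_eq_complexGaussian hx hx_law)
      (covariance_inner_of_map_eq_complexGaussian hx hx_law)
  set V : ℝ := s ^ 2 * p + τ with hV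
  have hVpos : 0 < V := by positivity
  have hβ0 : 0 ≤ β := by
    rw [hβ, distortionFactor]
    positivity
  have hEz : ∫ ω, ‖Q (y ω)‖ ^ 2 ∂μ = (1 - β) * V := by
    have h := hcm.integral_norm_sub_sq hym hQ hy2
    rw [distortionFactor, hEy, eq_div_iff hVpos.ne', h, hEy] at hβ
    linarith
  set c : ℝ := p * s / V with hc
  have hcV : c * V = p * s := by rw [hc]; field_simp
  have hxz := integral_inner_eq_of_condExp_eq (hQ.comp hym).comap_le
    (comap_measurable fun ω => Q (y ω)).stronglyMeasurable hz2 hx2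
    (hcm.condExp_input hx hn hx_law hn_law hxn hy hQ hcV)
  simp_rw [real_inner_smul_right, real_inner_self_eq_norm_sq] at hxz
  rw [integral_const_mul, hEz] at hxz
  have hW : 0 < β * p * s ^ 2 + τ := by positivity
  have hDpos : 0 < p * (β * p * s ^ 2 + τ) / V := by positivity
  -- Closed form of the estimation error `p - c² (1 - β) V`; `β ≥ 0` and `τ > 0` keep it positive.
  obtain ⟨D, hD⟩ : ∃ D : ℝ≥0, (D : ℝ) = p * (β * p * s ^ 2 + τ) / V := ⟨⟨_, hDpos.le⟩, rfl⟩
  have hD0 : D ≠ 0 := by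
    rw [← NNReal.coe_ne_zero, hD]
    exact hDpos.ne'
  have hcz2 : MemLp (fun ω => c • Q (y ω)) 2 μ := hz2.const_smul c
  have herr2 : MemLp (fun ω => x ω - c • Q (y ω)) 2 μ := hx2.sub hcz2
  have herr : ∫ ω, ‖x ω - c • Q (y ω)‖ ^ 2 ∂μ = D := by
    have hexpand : ∀ ω, ‖x ω - c • Q (y ω)‖ ^ 2
        = ‖x ω‖ ^ 2 - 2 * c * inner ℝ (Q (y ω)) (x ω) + c ^ 2 * ‖Q (y ω)‖ ^ 2 := fun ω => by
      rw [norm_sub_sq_real, real_inner_smul_right, real_inner_comm, norm_smul, mul_pow,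
        Real.norm_eq_abs, sq_abs]
      ring
    simp_rw [hexpand]
    have hi := (integrable_inner_of_memLp_two hz2 hx2).const_mul (2 * c)
    rw [integral_sub_add (hx2.integrable_norm_pow two_ne_zero) hi
      ((hz2.integrable_norm_pow two_ne_zero).const_mul _), integral_const_mul,
      integral_const_mul, hxz, hEx, hEz, hD, hc]
    field_simp
    rw [hV]
    ring
  refine ⟨fun q => Real.log (p / D) - ‖q.1 - c • q.2‖ ^ 2 / D + ‖q.1‖ ^ 2 / p, by fun_prop, ?_,
    fun z => lintegral_exp_complexGaussian_logRatio (c • z) hp hD0, ?_⟩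
  · exact ((integrable_const _).sub ((herr2.integrable_norm_pow two_ne_zero).div_const _)).add
      ((hx2.integrable_norm_pow two_ne_zero).div_const _)
  -- Both quadratic terms have mean `1` and cancel, leaving `log (p / D) = log (V / (β p s² + τ))`.
  · rw [integral_sub_add (integrable_const _)
      ((herr2.integrable_norm_pow two_ne_zero).div_const _)
      ((hx2.integrable_norm_pow two_ne_zero).div_const _),
      integral_div, integral_div, herr, hEx, div_self (NNReal.coe_ne_zero.2 hD0),
      div_self hp'.ne', integral_const, probReal_univ, one_smul, sub_add_cancel, hD]
    congr 1
    field_simp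
    rw [hV]
    ring

end Quantizer

/-! ### Per-stream and joint rate bounds. -/

theorem corollary1 {Ω : Type*} [MeasurableSpace Ω] (μ : Measure Ω) [IsProbabilityMeasure μ]
    (r : ℕ) (p : Fin r → ℝ≥0) (s : Fin r → ℝ) (σ : ℝ≥0) (hσ : 0 < σ)
    (x n y z : Fin r → Ω → ℂ)
    (hx : ∀ i, Measurable (x i)) (hn : ∀ i, Measurable (n i))
    (hx_law : ∀ i, μ.map (x i) = complexGaussian (p i))
    (hn_law : ∀ i, μ.map (n i) = complexGaussian (σ ^ 2))
    (h_indep : iIndepFun (Sum.elim x n) μ)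
    (hy : ∀ i ω, y i ω = (s i : ℂ) * x i ω + n i ω)
    (Q : Fin r → ℂ → ℂ) (hQ : ∀ i, Measurable (Q i))
    (hz : ∀ i ω, z i ω = Q i (y i ω))
    (hcm : ∀ i, HasConditionalMeanProperty μ (y i) (Q i))
    (β : Fin r → ℝ) (hβ : ∀ i, β i = distortionFactor μ (y i) (z i)) :
    (∀ i, ((Real.logb 2 (1 + (1 - β i) * (p i : ℝ) * s i ^ 2 /
        (β i * (p i : ℝ) * s i ^ 2 + (σ : ℝ) ^ 2)) : ℝ) : EReal) ≤
          (mutualInfoBits μ (x i) (z i) : EReal)) ∧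
    ((∑ i, Real.logb 2 (1 + (1 - β i) * (p i : ℝ) * s i ^ 2 /
        (β i * (p i : ℝ) * s i ^ 2 + (σ : ℝ) ^ 2)) : ℝ) : EReal) ≤
          (mutualInfoBits μ (fun ω i => x i ω) (fun ω i => z i ω) : EReal) := by
  have hxn : ∀ i, IndepFun (x i) (n i) μ := fun i =>
    h_indep.indepFun (i := Sum.inl i) (j := Sum.inr i) (by simp)
  have hxx : iIndepFun x μ := h_indep.precomp (g := Sum.inl) Sum.inl_injective
  have hzm : ∀ i, Measurable (z i) := fun i => by
    have hym : Measurable (y i) := by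
      rw [funext (hy i)]
      have := hx i
      have := hn i
      fun_prop
    rw [funext (hz i)]
    exact (hQ i).comp hym
  choose f hf hint hexp hval using fun i =>
    exists_logDensityRatio_of_conditionalMean (s := s i) (hx i) (hn i) (hx_law i) (hn_law i)
      (pow_pos hσ 2) (hxn i) (fun ω => by rw [hy, Complex.real_smul]) (hQ i) (hz i) (hcm i) (hβ i)
  simp_rw [NNReal.coe_pow] at hval
  refine ⟨fun i => ?_, ?_⟩
  · rw [Real.logb, ← hval i]
    exact integral_div_log_two_le_mutualInfoBits μ (hx i) (hzm i) (hf i) (hint i)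
      (by rw [hx_law i]; exact hexp i)
  · simp_rw [Real.logb, ← hval]
    rw [← Finset.sum_div, ← integral_finsetSum _ fun i _ => hint i]
    have hxm : Measurable fun ω i => x i ω := measurable_pi_lambda _ hx
    -- For a fixed output vector `w`, the exponential of the sum is a product of functions of the
    -- independent `x i`, so its integral is a product of ones.
    refine integral_div_log_two_le_mutualInfoBits μ hxm (measurable_pi_lambda _ hzm)
      (f := fun q : (Fin r → ℂ) × (Fin r → ℂ) => ∑ i, f i (q.1 i, q.2 i))
      (Finset.measurable_fun_sum _ fun i _ => (hf i).comp (by fun_prop))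
      (integrable_finsetSum _ fun i _ => hint i) fun w => ?_
    have hg : ∀ i, Measurable fun t => ENNReal.ofReal (Real.exp (f i (t, w i))) := fun i => by
      have := hf i
      fun_prop
    rw [lintegral_map (by
      refine ENNReal.measurable_ofReal.comp (Real.measurable_exp.comp
        (Finset.measurable_fun_sum _ fun i _ => (hf i).comp (by fun_prop)))) hxm]
    simp_rw [Real.exp_sum]
    simp_rw [ENNReal.ofReal_prod_of_nonneg fun i _ => (Real.exp_pos _).le]
    rw [lintegral_prod_eq_prod_lintegral_of_indepFun Finset.univ
      (fun i ω => ENNReal.ofReal (Real.exp (f i (x i ω, w i))))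
      (hxx.comp (fun i t => ENNReal.ofReal (Real.exp (f i (t, w i)))) hg)
      fun i => (hg i).comp (hx i)]
    refine Finset.prod_eq_one fun i _ => ?_
    rw [← hexp i (w i), ← hx_law i, lintegral_map (hg i) (hx i)]
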